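/- Let $q\in(2,\infty)$, and let $\ell_q$ denote the real Banach space of $q$-summable sequences. A metric space is $K$-doubling if each of its balls of radius $r>0$ can be covered by at most $K$ of its balls of radius $r/2$. A map $f:X\to Y$ between metric spaces is a bi-Lipschitz embedding with distortion $D$ if there is $s>0$ such that $s\,d_X(x,y)\le d_Y(f(x),f(y))\le D\,s\,d_X(x,y)$ for all $x,y\in X$. For $p\in[2,\infty)$, a real Banach space $Y$ is $p$-uniformly convex if there is $c>0$ such that $1-\left\|\frac{x+y}{2}\right\|\ge c\,t^p$ whenever $t>0$, $\|x\|=\|y\|=1$ and $\|x-y\|\ge t$; that is, its modulus of uniform convexity satisfies $\delta_Y(t)\ge c\,t^p$ for all $t>0$. There is a constant $c_2>0$ depending only on $q$, and for every real Banach space $Y$ and every $p\in[2,q)$ there is a constant $c_1>0$ depending only on $p$, $q$ and $Y$, such that the following holds. Let $Y$ be a real Banach space and let $D\ge 1$. For every $n\in\mathbb{N}$ there exists an $n$-point subset $\mathcal{L}_n=\mathcal{L}_n(q,D,Y)$ of $\ell_q$ which, with the induced metric, is $2^{32}$-doubling and such that, whenever $\mathcal{L}_n$ admits a bi-Lipschitz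 embedding with distortion $D$ into $Y$, one has 1. $D\ge c_1(\log n)^{\frac1p-\frac1q}$ for every $p\in[2,q)$ for which $Y$ is $p$-uniformly convex; and 2. $D\ge c_2\left(\frac{\log n}{d}\right)^{\frac12-\frac1q}$ if $Y=\ell_q^d$ (up to linear isometry) for some integer $d\ge 1$. -/

import Mathlib

open scoped ENNReal

/-- The real sequence space `ℓ_q` (over `ℕ`), for a real exponent `q`. -/
abbrev EllSeq (q : ℝ) : Type :=
  lp (fun _ : ℕ => ℝ) (ENNReal.ofReal q)

/-- The finite-dimensional real space `ℓ_q^d`, for a real exponent `q`. -/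
abbrev EllFin (q : ℝ) (d : ℕ) : Type :=
  PiLp (ENNReal.ofReal q) (fun _ : Fin d => ℝ)

/-- A metric space `X` is `K`-doubling if every closed ball of radius `r` can be covered by at most
`K` closed balls of radius `r / 2` (all balls are balls of `X`, so the centres lie in `X`). -/
def IsDoublingSpace (K : ℕ) (X : Type*) [MetricSpace X] : Prop :=
  ∀ (x : X) (r : ℝ), 0 < r → ∃ t : Finset X, t.card ≤ K ∧
    Metric.closedBall x r ⊆ ⋃ y ∈ t, Metric.closedBall y (r / 2)

/-- `f` is a bi-Lipschitz embedding with distortion (at most) `D`: up to a scaling factor `s`,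
distances are not contracted and are expanded by at most `D`. -/
def EmbedsWithDistortion {X Y : Type*} [MetricSpace X] [MetricSpace Y]
    (f : X → Y) (D : ℝ) : Prop :=
  ∃ s : ℝ, 0 < s ∧ ∀ x y : X,
    s * dist x y ≤ dist (f x) (f y) ∧ dist (f x) (f y) ≤ D * s * dist x y

/-- The modulus of uniform convexity
`δ_Y(t) = inf {1 - ‖(x + y) / 2‖ : ‖x‖ = ‖y‖ = 1, ‖x - y‖ ≥ t}`,
with values in the extended reals, so that the infimum of the empty set is `+∞`. -/
noncomputable def convexityModulus (Y : Type*) [NormedAddCommGroup Y] [NormedSpace ℝ Y]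
    (t : ℝ) : EReal :=
  ⨅ (x : Y) (y : Y) (_ : ‖x‖ = 1) (_ : ‖y‖ = 1) (_ : t ≤ ‖x - y‖),
    ((1 - ‖(2⁻¹ : ℝ) • (x + y)‖ : ℝ) : EReal)

/-- `Y` is `p`-uniformly convex: `δ_Y(t) ≥ c t ^ p` for all `t > 0`, for some constant `c > 0`. -/
def IsPowerUniformlyConvex (p : ℝ) (Y : Type*) [NormedAddCommGroup Y] [NormedSpace ℝ Y] : Prop :=
  ∃ c : ℝ, 0 < c ∧ ∀ t : ℝ, 0 < t → ((c * t ^ p : ℝ) : EReal) ≤ convexityModulus Y t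

/-! The sets are vertex sets of a thin Laakso-type graph in `ℓ_q`. A point has an abscissa in
coordinate 0 and, in a separate coordinate for each level `i < k`, a bump of width `4⁻ⁱ` and
relative height `δ = (k+1)^(-1/q)` with a free sign. Since `k δ^q ≤ 1`, all levels together keep the
curves of fixed signs 2-Lipschitz.

Doubling: in a ball of radius `r`, levels finer than `r/δ` are negligible. At a coarser level, a
sign matters without being determined only near the foot of a bump. There `4^(i+1) x` is almost an
integer, so the following bumps vanish until their width is comparable with `r/δ`; boundedly many
signs stay free (`card_freeLevels_le`).

Distortion: an edge of level `j` consists of four edges of level `j+1`, and the two choices of sign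
at level `j` give two midpoints, `2δ` apart after rescaling. Uniform convexity of `Y` then forces
the rescaled image of the long edge to be shorter by about `δ^p D^(1-p)` than the bound for the
short ones (`edgeBound_step`). Edges of level `k` have rescaled length at most `2D` and lengths are
nonnegative, so `k δ^p ≲ D^p`, that is `D ≳ k^(1/p-1/q)`, where `k` is of order `log n`.

For `Y = ℓ_q^d`, pass to Euclidean space at the cost of a factor `d^(1/2-1/q)` and use `p = 2`. -/

/-! ### The bump function -/

/-- The bump `u ↦ max 0 (d(u, ℤ) - 1 / 4)`, supported on the middle halves of the unit intervals. -/
noncomputable def bump (u : ℝ) : ℝ := max 0 (|u - round u| - 1 / 4)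

lemma bump_nonneg (u : ℝ) : 0 ≤ bump u := le_max_left _ _

lemma bump_le (u : ℝ) : bump u ≤ 1 / 4 := by
  have := abs_sub_round u
  exact max_le (by norm_num) (by linarith)

lemma bump_sub_le (u v : ℝ) : bump u - bump v ≤ |u - v| := by
  have h1 := round_le u (round v)
  have h2 : |u - round v| ≤ |u - v| + |v - round v| := abs_sub_le u v _
  have h3 : |v - round v| - 1 / 4 ≤ bump v := le_max_right _ _
  have h4 := bump_nonneg v
  have : bump u ≤ |u - v| + bump v := max_le (by positivity) (by linarith)
  linarith

lemma abs_bump_sub_le (u v : ℝ) : |bump u - bump v| ≤ |u - v| :=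
  abs_sub_le_iff.2 ⟨bump_sub_le u v, abs_sub_comm u v ▸ bump_sub_le v u⟩

lemma bump_eq_zero {u : ℝ} (N : ℤ) (h : |u - N| ≤ 1 / 4) : bump u = 0 := by
  have := round_le u N
  exact max_eq_left (by linarith)

lemma bump_add_half (m : ℕ) : bump ((m : ℝ) + 1 / 2) = 1 / 4 := by
  have h : round ((m : ℝ) + 1 / 2) = (m : ℤ) + 1 := by
    rw [round_eq]
    have : (m : ℝ) + 1 / 2 + 1 / 2 = ((m + 1 : ℤ) : ℝ) := by push_cast; ring
    rw [this, Int.floor_intCast]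
  rw [bump, h]
  push_cast
  rw [show (m : ℝ) + 1 / 2 - (m + 1) = -(1 / 2) by ring, abs_neg, abs_of_pos (by norm_num)]
  norm_num

/-- Where the bump is positive but small, four times the argument is close to an integer. -/
lemma exists_int_near_of_bump_pos {u ρ : ℝ} (h0 : bump u ≠ 0) (h : bump u ≤ ρ) :
    ∃ N : ℤ, |4 * u - N| ≤ 4 * ρ := by
  have h1 : 1 / 4 < |u - round u| := by
    by_contra! hc
    exact h0 (bump_eq_zero _ hc)
  have h2 : |u - round u| - 1 / 4 ≤ ρ := (le_max_right _ _).trans h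
  rcases abs_cases (u - round u) with ⟨h3, -⟩ | ⟨h3, -⟩
  · refine ⟨4 * round u + 1, ?_⟩
    push_cast
    rw [abs_le]; constructor <;> linarith
  · refine ⟨4 * round u - 1, ?_⟩
    push_cast
    rw [abs_le]; constructor <;> linarith

/-! ### The points of the construction -/

/-- The relative height of the bumps in the construction with `k` levels. -/
noncomputable def bumpHeight (q : ℝ) (k : ℕ) : ℝ := ((k : ℝ) + 1) ^ (-1 / q)

lemma bumpHeight_pos (q : ℝ) (k : ℕ) : 0 < bumpHeight q k := by
  unfold bumpHeight; positivity

lemma bumpHeight_le_one {q : ℝ} (hq : 0 < q) (k : ℕ) : bumpHeight q k ≤ 1 :=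
  Real.rpow_le_one_of_one_le_of_nonpos (by simp) (div_nonpos_of_nonpos_of_nonneg (by simp) hq.le)

lemma bumpHeight_rpow (q : ℝ) (k : ℕ) (p : ℝ) :
    bumpHeight q k ^ p = ((k : ℝ) + 1) ^ (-(p / q)) := by
  rw [bumpHeight, ← Real.rpow_mul (by positivity)]
  congr 1; ring

lemma mul_bumpHeight_rpow_le {q : ℝ} (hq : 0 < q) (k : ℕ) : k * bumpHeight q k ^ q ≤ 1 := by
  rw [bumpHeight_rpow, div_self hq.ne', Real.rpow_neg_one, ← div_eq_mul_inv,
    div_le_one (by positivity)]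
  linarith

/-- The height at abscissa `x` of the bumps of level `i`. -/
noncomputable def levelBump (q : ℝ) (k i : ℕ) (x : ℝ) : ℝ :=
  bumpHeight q k / 4 ^ i * bump (4 ^ i * x)

lemma levelBump_nonneg (q : ℝ) (k i : ℕ) (x : ℝ) : 0 ≤ levelBump q k i x :=
  mul_nonneg (div_nonneg (bumpHeight_pos q k).le (by positivity)) (bump_nonneg _)

lemma levelBump_le (q : ℝ) (k i : ℕ) (x : ℝ) :
    levelBump q k i x ≤ bumpHeight q k / 4 ^ i / 4 := by
  have := bumpHeight_pos q k
  calc levelBump q k i x ≤ bumpHeight q k / 4 ^ i * (1 / 4) :=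
        mul_le_mul_of_nonneg_left (bump_le _) (by positivity)
    _ = _ := by ring

lemma abs_levelBump_sub_le (q : ℝ) (k i : ℕ) (x y : ℝ) :
    |levelBump q k i x - levelBump q k i y| ≤ bumpHeight q k * |x - y| := by
  have := bumpHeight_pos q k
  rw [levelBump, levelBump, ← mul_sub, abs_mul, abs_of_pos (by positivity)]
  calc _ ≤ bumpHeight q k / 4 ^ i * |4 ^ i * x - 4 ^ i * y| :=
        mul_le_mul_of_nonneg_left (abs_bump_sub_le _ _) (by positivity)
    _ = _ := by
      rw [← mul_sub, abs_mul, abs_of_pos (by positivity : (0 : ℝ) < 4 ^ i)]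
      field_simp

/-- The sign attached to level `i` by the set `T`. -/
noncomputable def levelSign (T : Finset ℕ) (i : ℕ) : ℝ := if i ∈ T then 1 else -1

lemma abs_levelSign (T : Finset ℕ) (i : ℕ) : |levelSign T i| = 1 := by
  unfold levelSign; split_ifs <;> simp

lemma levelSign_eq {T T' : Finset ℕ} {i : ℕ} (h : i ∈ T ↔ i ∈ T') :
    levelSign T i = levelSign T' i := by
  simp [levelSign, h]

lemma levelSign_neg {T T' : Finset ℕ} {i : ℕ} (h : ¬(i ∈ T ↔ i ∈ T')) :
    levelSign T i = -levelSign T' i := by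
  by_cases h1 : i ∈ T <;> by_cases h2 : i ∈ T' <;> simp_all [levelSign]

/-- The coordinates of the point with abscissa `x` and signs `T`. -/
noncomputable def laaksoCoord (q : ℝ) (k : ℕ) (x : ℝ) (T : Finset ℕ) : ℕ → ℝ
  | 0 => x
  | i + 1 => if i < k then levelSign T i * levelBump q k i x else 0

/-- The point of `ℓ_q` with abscissa `x` and signs `T`. -/
noncomputable def laaksoPoint (q : ℝ) (k : ℕ) (x : ℝ) (T : Finset ℕ) : EllSeq q :=
  ⟨laaksoCoord q k x T, by
    refine Memℓp.of_exponent_ge (memℓp_zero ?_) (zero_le)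
    refine (Set.finite_Iio (k + 1)).subset fun i hi => ?_
    cases i with
    | zero => simp
    | succ i =>
      by_contra hc
      simp only [Set.mem_Iio, add_lt_add_iff_right] at hc
      exact hi (by simp [laaksoCoord, hc])⟩

lemma laaksoPoint_zero (q : ℝ) (k : ℕ) (x : ℝ) (T : Finset ℕ) :
    laaksoPoint q k x T 0 = x := rfl

lemma laaksoPoint_succ (q : ℝ) (k : ℕ) (x : ℝ) (T : Finset ℕ) {i : ℕ} (hi : i < k) :
    laaksoPoint q k x T (i + 1) = levelSign T i * levelBump q k i x := if_pos hi

lemma laaksoPoint_succ_of_le (q : ℝ) (k : ℕ) (x : ℝ) (T : Finset ℕ) {i : ℕ} (hi : k ≤ i) :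
    laaksoPoint q k x T (i + 1) = 0 := if_neg hi.not_gt

lemma sum_le_sum_of_support {ι : Type*} {s t : Finset ι} {a : ι → ℝ} (ha : ∀ i, 0 ≤ a i)
    (h : ∀ i ∈ s, a i ≠ 0 → i ∈ t) : ∑ i ∈ s, a i ≤ ∑ i ∈ t, a i := by
  classical
  rw [← Finset.sum_filter_ne_zero]
  refine Finset.sum_le_sum_of_subset_of_nonneg (fun i hi => ?_) fun i _ _ => ha i
  rw [Finset.mem_filter] at hi
  exact h i hi.1 hi.2

/-! ### Distances between the points -/

section dist
variable {q : ℝ}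

lemma ellSeq_norm_le (hq : 0 < q) {f : EllSeq q} {C : ℝ} (hC : 0 ≤ C)
    (h : ∀ s : Finset ℕ, ∑ i ∈ s, |f i| ^ q ≤ C ^ q) : ‖f‖ ≤ C := by
  have hq' : (ENNReal.ofReal q).toReal = q := ENNReal.toReal_ofReal hq.le
  refine lp.norm_le_of_forall_sum_le (by rwa [hq']) hC fun s => ?_
  rw [hq']; exact h s

lemma abs_apply_le_norm (hq : 0 < q) (f : EllSeq q) (i : ℕ) : |f i| ≤ ‖f‖ :=
  lp.norm_apply_le_norm (by simpa using hq) f i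

/-- The `ℓ_1` norm dominates the `ℓ_q` norm: each entry is at most `C`, so `|f i| ^ q ≤ |f i| * C ^
(q - 1)`. -/
lemma ellSeq_norm_le_of_sum_le (hq : 1 ≤ q) {f : EllSeq q} {C : ℝ} (hC : 0 ≤ C)
    (h : ∀ s : Finset ℕ, ∑ i ∈ s, |f i| ≤ C) : ‖f‖ ≤ C := by
  have hq0 : 0 < q := by linarith
  refine ellSeq_norm_le hq0 hC fun s => ?_
  have hpow : ∀ a : ℝ, 0 ≤ a → a ^ q = a * a ^ (q - 1) := fun a ha => by
    rw [← Real.rpow_one_add' ha (by linarith)]; congr 1; ring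
  calc ∑ i ∈ s, |f i| ^ q ≤ ∑ i ∈ s, |f i| * C ^ (q - 1) := by
        refine Finset.sum_le_sum fun i _ => ?_
        rw [hpow _ (abs_nonneg _)]
        refine mul_le_mul_of_nonneg_left ?_ (abs_nonneg _)
        refine Real.rpow_le_rpow (abs_nonneg _) ?_ (by linarith)
        simpa using h {i}
    _ = (∑ i ∈ s, |f i|) * C ^ (q - 1) := (Finset.sum_mul ..).symm
    _ ≤ C * C ^ (q - 1) := mul_le_mul_of_nonneg_right (h s) (by positivity)
    _ = C ^ q := (hpow C hC).symm

variable [Fact (1 ≤ ENNReal.ofReal q)]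

/-- The abscissa contributes `|x - y| ^ q`, and the `k` levels together contribute at most `k δ^q |x
- y| ^ q ≤ |x - y| ^ q`; this is what fixes the height `δ`. -/
lemma dist_laaksoPoint_same_signs (hq : 1 ≤ q) (k : ℕ) (x y : ℝ) (T : Finset ℕ) :
    dist (laaksoPoint q k x T) (laaksoPoint q k y T) ≤ 2 * |x - y| := by
  have hq0 : 0 < q := by linarith
  rw [dist_eq_norm]
  refine ellSeq_norm_le hq0 (by positivity) fun s => ?_
  have hδ := bumpHeight_pos q k
  set a : ℕ → ℝ := fun i => |(laaksoPoint q k x T - laaksoPoint q k y T : EllSeq q) i| ^ q with ha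
  have ha0 : ∀ i, 0 ≤ a i := fun i => by positivity
  have h1 : ∀ i, k + 1 ≤ i → a i = 0 := by
    intro i hi
    obtain ⟨i, rfl⟩ : ∃ j, i = j + 1 := ⟨i - 1, by omega⟩
    simp only [ha, lp.coeFn_sub, Pi.sub_apply,
      laaksoPoint_succ_of_le q k _ T (show k ≤ i by omega)]
    simp [hq0.ne']
  have h2 : ∑ i ∈ s, a i ≤ ∑ i ∈ Finset.range (k + 1), a i := by
    refine sum_le_sum_of_support ha0 fun i _ hi => ?_
    by_contra hc
    exact hi (h1 i (by simpa using hc))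
  refine h2.trans ?_
  rw [Finset.sum_range_succ']
  have h3 : ∀ i ∈ Finset.range k, a (i + 1) ≤ bumpHeight q k ^ q * |x - y| ^ q := by
    intro i hi
    rw [← Real.mul_rpow hδ.le (abs_nonneg _)]
    refine Real.rpow_le_rpow (abs_nonneg _) ?_ hq0.le
    simp only [lp.coeFn_sub, Pi.sub_apply, laaksoPoint_succ q k _ T (Finset.mem_range.1 hi)]
    rw [← mul_sub, abs_mul, abs_levelSign, one_mul]
    exact abs_levelBump_sub_le ..
  have h4 : a 0 = |x - y| ^ q := by
    simp [ha, laaksoPoint_zero]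
  have h5 := Finset.sum_le_sum h3
  rw [Finset.sum_const, Finset.card_range, nsmul_eq_mul, ← mul_assoc] at h5
  have h6 : 0 ≤ |x - y| ^ q := by positivity
  have h7 : (2 : ℝ) ≤ 2 ^ q := by
    simpa using Real.rpow_le_rpow_of_exponent_le (one_le_two (α := ℝ)) hq
  rw [Real.mul_rpow (by norm_num) (abs_nonneg _), h4]
  nlinarith [mul_le_mul_of_nonneg_right (mul_bumpHeight_rpow_le hq0 k) h6,
    mul_le_mul_of_nonneg_right h7 h6]

lemma sum_Ico_inv_four_pow_le (a b : ℕ) :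
    ∑ i ∈ Finset.Ico a b, ((1 : ℝ) / 4 ^ i) ≤ 4 / 3 * (1 / 4 ^ a) := by
  have : ∀ b, a ≤ b → ∑ i ∈ Finset.Ico a b, ((1 : ℝ) / 4 ^ i) = 4 / 3 * (1 / 4 ^ a - 1 / 4 ^ b) := by
    intro b hb
    induction b, hb using Nat.le_induction with
    | base => simp
    | succ b hb ih => rw [Finset.sum_Ico_succ_top hb, ih]; field_simp; ring
  rcases le_total a b with h | h
  · rw [this b h]
    have : (0 : ℝ) < 1 / 4 ^ b := by positivity
    linarith
  · rw [Finset.Ico_eq_empty_of_le h]; simp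

/-- Two points with the same abscissa whose signs agree, or do not matter, up to level `i₀`. -/
lemma dist_laaksoPoint_same_abscissa (hq : 1 ≤ q) (k : ℕ) (x : ℝ) (T T' : Finset ℕ) (i₀ : ℕ)
    (h : ∀ i ≤ i₀, i < k → (i ∈ T ↔ i ∈ T') ∨ levelBump q k i x = 0) :
    dist (laaksoPoint q k x T) (laaksoPoint q k x T') ≤ bumpHeight q k / 4 ^ i₀ / 4 := by
  have hδ := bumpHeight_pos q k
  rw [dist_eq_norm]
  refine ellSeq_norm_le_of_sum_le hq (by positivity) fun s => ?_
  set a : ℕ → ℝ := fun i => |(laaksoPoint q k x T - laaksoPoint q k x T' : EllSeq q) i| with ha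
  have ha0 : a 0 = 0 := by simp [ha, laaksoPoint_zero]
  have ha1 : ∀ i, k ≤ i → a (i + 1) = 0 := fun i hi => by
    simp only [ha, lp.coeFn_sub, Pi.sub_apply, laaksoPoint_succ_of_le q k _ _ hi]
    simp
  have ha2 : ∀ i, i < k → a (i + 1) = |levelSign T i - levelSign T' i| * levelBump q k i x := by
    intro i hi
    simp only [ha, lp.coeFn_sub, Pi.sub_apply, laaksoPoint_succ q k _ _ hi]
    rw [← sub_mul, abs_mul, abs_of_nonneg (levelBump_nonneg q k i x)]
  have ha3 : ∀ i ≤ i₀, a (i + 1) = 0 := fun i hi => by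
    rcases lt_or_ge i k with hk | hk
    · rw [ha2 i hk]
      rcases h i hi hk with h1 | h1
      · simp [levelSign_eq h1]
      · simp [h1]
    · exact ha1 i hk
  have ha4 : ∀ i, i < k → a (i + 1) ≤ bumpHeight q k / 2 * (1 / 4 ^ i) := fun i hi => by
    rw [ha2 i hi]
    have h1 : |levelSign T i - levelSign T' i| ≤ 2 := by
      have := abs_sub (levelSign T i) (levelSign T' i)
      rw [abs_levelSign, abs_levelSign] at this
      linarith
    calc _ ≤ 2 * (bumpHeight q k / 4 ^ i / 4) :=
          mul_le_mul h1 (levelBump_le q k i x) (levelBump_nonneg ..) (by norm_num)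
      _ = _ := by ring
  -- Coordinate `i + 1` carries level `i`, so only levels from `i₀ + 1` to `k - 1` survive, and they
  -- form a geometric tail.
  have h2 : ∑ i ∈ s, a i ≤ ∑ i ∈ Finset.Ico (i₀ + 1 + 1) (k + 1), a i := by
    refine sum_le_sum_of_support (fun i => abs_nonneg _) fun i _ hi => ?_
    rw [Finset.mem_Ico]
    cases i with
    | zero => exact absurd ha0 hi
    | succ i =>
      by_contra hc
      by_cases hik : k ≤ i
      · exact hi (ha1 i hik)
      · exact hi (ha3 i (by omega))
  refine h2.trans ?_
  rw [← Finset.sum_Ico_add' a (i₀ + 1) k 1]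
  calc ∑ i ∈ Finset.Ico (i₀ + 1) k, a (i + 1)
      ≤ ∑ i ∈ Finset.Ico (i₀ + 1) k, bumpHeight q k / 2 * (1 / 4 ^ i) :=
        Finset.sum_le_sum fun i hi => ha4 i (Finset.mem_Ico.1 hi).2
    _ = bumpHeight q k / 2 * ∑ i ∈ Finset.Ico (i₀ + 1) k, (1 / 4 ^ i : ℝ) :=
        (Finset.mul_sum ..).symm
    _ ≤ bumpHeight q k / 2 * (4 / 3 * (1 / 4 ^ (i₀ + 1))) :=
        mul_le_mul_of_nonneg_left (sum_Ico_inv_four_pow_le _ _) (by positivity)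
    _ = bumpHeight q k / 4 ^ i₀ / 6 := by rw [pow_succ]; field_simp; ring
    _ ≤ _ := by
      have : 0 < bumpHeight q k / 4 ^ i₀ := by positivity
      linarith

lemma abs_sub_le_dist_laaksoPoint (hq : 0 < q) (k : ℕ) (x y : ℝ) (T T' : Finset ℕ) :
    |x - y| ≤ dist (laaksoPoint q k x T) (laaksoPoint q k y T') := by
  rw [dist_eq_norm]
  simpa [laaksoPoint_zero] using
    abs_apply_le_norm hq (laaksoPoint q k x T - laaksoPoint q k y T') 0

lemma add_levelBump_le_dist_laaksoPoint (hq : 0 < q) {k i : ℕ} (hi : i < k) (x y : ℝ)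
    {T T' : Finset ℕ} (h : ¬(i ∈ T ↔ i ∈ T')) :
    levelBump q k i x + levelBump q k i y ≤
      dist (laaksoPoint q k x T) (laaksoPoint q k y T') := by
  rw [dist_eq_norm]
  have h1 := abs_apply_le_norm hq (laaksoPoint q k x T - laaksoPoint q k y T') (i + 1)
  simp only [lp.coeFn_sub, Pi.sub_apply, laaksoPoint_succ q k _ _ hi] at h1
  rw [levelSign_neg h, neg_mul, ← neg_add', abs_neg, ← mul_add, abs_mul, abs_levelSign, one_mul,
    abs_of_nonneg (add_nonneg (levelBump_nonneg ..) (levelBump_nonneg ..))] at h1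
  exact h1

end dist

/-! ### The doubling property -/

/-- The centres must lie in `S`, so each class is represented by one of its own members inside the
ball. -/
lemma isDoublingSpace_of_classes {E γ : Type*} [MetricSpace E] (K : ℕ) (S : Set E)
    (h : ∀ a ∈ S, ∀ r : ℝ, 0 < r → ∃ (φ : E → γ) (V : Finset γ), V.card ≤ K ∧
      (∀ b ∈ S, dist b a ≤ r → φ b ∈ V) ∧
      ∀ b ∈ S, ∀ c ∈ S, dist b a ≤ r → dist c a ≤ r → φ b = φ c → dist b c ≤ r / 2) :
    IsDoublingSpace K S := by
  classical
  rintro ⟨a, ha⟩ r hr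
  obtain ⟨φ, V, hK, hV, hφ⟩ := h a ha r hr
  have : Nonempty S := ⟨⟨a, ha⟩⟩
  set ψ : S → γ := fun b => φ b
  set B : Set S := Metric.closedBall ⟨a, ha⟩ r with hB
  refine ⟨V.image (Function.invFunOn ψ B), Finset.card_image_le.trans hK, fun b hb => ?_⟩
  have hex : ∃ c ∈ B, ψ c = ψ b := ⟨b, hb, rfl⟩
  have h1 := Function.invFunOn_mem hex
  have h2 := Function.invFunOn_eq hex
  simp only [Set.mem_iUnion]
  exact ⟨_, Finset.mem_image_of_mem _ (hV b b.2 hb), hφ b b.2 _ (Subtype.property _) hb h1 h2.symm⟩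

/-- The levels up to `i₀` for which the sign of a point at distance at most `r` from a point with
abscissa `x` is neither determined nor irrelevant. -/
noncomputable def freeLevels (q : ℝ) (k : ℕ) (x r : ℝ) (i₀ : ℕ) : Finset ℕ :=
  open Classical in
  (Finset.range (i₀ + 1)).filter fun i =>
    levelBump q k i x ≤ r ∧ ∃ y, |y - x| ≤ r ∧ levelBump q k i y ≠ 0

/-- If `i` is free, some `y` in the interval has a positive but small bump of level `i`, so `4^(i+1)
y` is near an integer. Hence on the whole interval a bump of level `j > i` vanishes, unless `4^j r`
is comparable with `δ`. -/
lemma lt_add_three_of_mem_freeLevels {q : ℝ} (hq : 0 < q) {k i₀ i j : ℕ} {x r : ℝ}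
    (hr : 4 ^ i₀ * r < 4 * bumpHeight q k) (hi : i ∈ freeLevels q k x r i₀)
    (hj : j ∈ freeLevels q k x r i₀) (hij : i < j) : i₀ < j + 3 := by
  classical
  by_contra! hc
  simp only [freeLevels, Finset.mem_filter, Finset.mem_range] at hi hj
  obtain ⟨-, hix, y, hyx, hy⟩ := hi
  obtain ⟨-, -, z, hzx, hz⟩ := hj
  have hδ := bumpHeight_pos q k
  have hδ1 := bumpHeight_le_one hq k
  have hr0 : 0 ≤ r := (abs_nonneg _).trans hyx
  -- Level bumps are 1-Lipschitz because `δ ≤ 1`.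
  have h1 : levelBump q k i y ≤ 2 * r := by
    have h2 := (abs_le.1 (abs_levelBump_sub_le q k i y x)).2
    nlinarith [abs_nonneg (y - x)]
  set ρ := 4 ^ i * r / bumpHeight q k with hρ
  have h4r : 4 ^ i * r ≤ ρ := by
    rw [hρ, le_div_iff₀ hδ]
    exact mul_le_of_le_one_right (by positivity) hδ1
  have h0 : bump (4 ^ i * y) ≠ 0 := fun h => hy (by rw [levelBump, h, mul_zero])
  have h2 : bump (4 ^ i * y) ≤ 2 * ρ := by
    rw [levelBump, div_mul_eq_mul_div, div_le_iff₀ (by positivity)] at h1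
    rw [hρ, mul_div_assoc', le_div_iff₀ hδ]
    linarith
  obtain ⟨N, hN⟩ := exists_int_near_of_bump_pos h0 h2
  obtain ⟨m, rfl⟩ : ∃ m, j = i + 1 + m := ⟨j - i - 1, by omega⟩
  have hzy : |z - y| ≤ 2 * r := by
    have := abs_sub_le z x y
    rw [abs_sub_comm x y] at this
    linarith
  have hzN : |4 * (4 ^ i * z) - N| ≤ 16 * ρ := by
    have e : 4 * (4 ^ i * z) - N = 4 * (4 ^ i * y) - N + 4 * (4 ^ i * (z - y)) := by ring
    have h5 : |4 * (4 ^ i * (z - y))| ≤ 8 * ρ := by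
      rw [abs_mul, abs_mul, abs_of_pos (by norm_num : (0 : ℝ) < 4),
        abs_of_pos (by positivity : (0 : ℝ) < 4 ^ i)]
      have : (4 : ℝ) ^ i * |z - y| ≤ 4 ^ i * (2 * r) :=
        mul_le_mul_of_nonneg_left hzy (by positivity)
      linarith
    rw [e]
    have := abs_add_le (4 * (4 ^ i * y) - N) (4 * (4 ^ i * (z - y)))
    linarith
  have hz0 : bump (4 ^ (i + 1 + m) * z) = 0 := by
    refine bump_eq_zero (4 ^ m * N) ?_
    have e : (4 : ℝ) ^ (i + 1 + m) * z - ((4 ^ m * N : ℤ) : ℝ)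
        = 4 ^ m * (4 * (4 ^ i * z) - N) := by push_cast; ring
    rw [e, abs_mul, abs_of_pos (by positivity : (0 : ℝ) < 4 ^ m)]
    -- This is where `j + 3 ≤ i₀` enters: `4^(j+3) r ≤ 4^i₀ r < 4δ`.
    have h6 : (4 : ℝ) ^ m * (16 * ρ) ≤ 1 / 4 := by
      rw [hρ, mul_div_assoc', mul_div_assoc', div_le_iff₀ hδ]
      have h7 : (4 : ℝ) ^ (i + 1 + m + 3) ≤ 4 ^ i₀ := pow_le_pow_right₀ (by norm_num) hc
      have h8 := mul_le_mul_of_nonneg_right h7 hr0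
      have e2 : (4 : ℝ) ^ (i + 1 + m + 3) * r = 16 * (4 ^ m * (16 * (4 ^ i * r))) := by ring
      linarith
    exact (mul_le_mul_of_nonneg_left hzN (by positivity)).trans h6
  exact hz (by rw [levelBump, hz0, mul_zero])

/-- Apart from the smallest free level, only `i₀ - 2`, `i₀ - 1` and `i₀` can be free. -/
lemma card_freeLevels_le {q : ℝ} (hq : 0 < q) {k i₀ : ℕ} {x r : ℝ}
    (hr : i₀ ≠ 0 → 4 ^ i₀ * r < 4 * bumpHeight q k) : (freeLevels q k x r i₀).card ≤ 4 := by
  classical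
  have hle : ∀ i ∈ freeLevels q k x r i₀, i ≤ i₀ := fun i hi => by
    simp only [freeLevels, Finset.mem_filter, Finset.mem_range] at hi
    omega
  rcases (freeLevels q k x r i₀).eq_empty_or_nonempty with h0 | h0
  · simp [h0]
  · have hsub : freeLevels q k x r i₀ ⊆
        insert ((freeLevels q k x r i₀).min' h0) (Finset.Icc (i₀ - 2) i₀) := by
      intro j hj
      rw [Finset.mem_insert, Finset.mem_Icc]
      rcases ((freeLevels q k x r i₀).min'_le j hj).eq_or_lt with h | h
      · exact Or.inl h.symm
      · have h1 := hle j hj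
        have := lt_add_three_of_mem_freeLevels hq (hr (by omega)) (Finset.min'_mem _ h0) hj h
        exact Or.inr ⟨by omega, h1⟩
    refine (Finset.card_le_card hsub).trans ((Finset.card_insert_le _ _).trans ?_)
    rw [Nat.card_Icc]; omega

/-- The least scale at which bumps have height `O(r)`; minimality gives the reverse estimate, except
when scale 0 already works. -/
lemma exists_levelScale {q : ℝ} (k : ℕ) {r : ℝ} (hr : 0 < r) :
    ∃ i₀ : ℕ, bumpHeight q k / 4 ^ i₀ ≤ r ∧ (i₀ ≠ 0 → 4 ^ i₀ * r < 4 * bumpHeight q k) := by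
  classical
  have hex : ∃ i : ℕ, bumpHeight q k / 4 ^ i ≤ r := by
    obtain ⟨i, hi⟩ := pow_unbounded_of_one_lt (bumpHeight q k / r) (by norm_num : (1 : ℝ) < 4)
    refine ⟨i, ?_⟩
    rw [div_lt_iff₀ hr] at hi
    rw [div_le_iff₀ (by positivity)]
    linarith
  refine ⟨Nat.find hex, Nat.find_spec hex, fun h0 => ?_⟩
  obtain ⟨m, hm⟩ := Nat.exists_eq_succ_of_ne_zero h0
  have := Nat.find_min hex (m := m) (by omega)
  rw [not_le, lt_div_iff₀ (by positivity)] at this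
  rw [hm, Nat.succ_eq_add_one, pow_succ]
  linarith

theorem isDoublingSpace_of_forall_laaksoPoint {q : ℝ} [Fact (1 ≤ ENNReal.ofReal q)] (hq : 1 ≤ q)
    (k : ℕ) (S : Set (EllSeq q)) (hS : ∀ a ∈ S, ∃ x T, laaksoPoint q k x T = a) :
    IsDoublingSpace (2 ^ 32) S := by
  classical
  have hq0 : 0 < q := by linarith
  choose! X T hXT using hS
  refine isDoublingSpace_of_classes (γ := ℤ × Finset ℕ) _ _ fun a ha r hr => ?_
  obtain ⟨i₀, hi₀, hi₀'⟩ := exists_levelScale (q := q) k hr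
  set I := freeLevels q k (X a) r i₀ with hI
  have hX : ∀ b ∈ S, dist b a ≤ r → |X b - X a| ≤ r := fun b hb hba => by
    refine (abs_sub_le_dist_laaksoPoint hq0 k _ _ (T b) (T a)).trans ?_
    rwa [hXT b hb, hXT a ha]
  have hT : ∀ b ∈ S, dist b a ≤ r → ∀ i ≤ i₀, i < k → i ∉ I →
      (∀ y, |y - X a| ≤ r → levelBump q k i y = 0) ∨ (i ∈ T b ↔ i ∈ T a) := by
    intro b hb hba i hi hik hiI
    by_contra! hc
    obtain ⟨hc1, hc2⟩ := hc
    refine hiI ?_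
    simp only [hI, freeLevels, Finset.mem_filter, Finset.mem_range]
    refine ⟨by omega, ?_, hc1⟩
    have h1 := add_levelBump_le_dist_laaksoPoint hq0 hik (X b) (X a) (T := T b) (T' := T a)
      (by tauto)
    rw [hXT b hb, hXT a ha] at h1
    have := levelBump_nonneg q k i (X b)
    linarith
  -- Cells of abscissae of width `r / 8` cost `r / 4` by the 2-Lipschitz bound, and levels beyond
  -- `i₀` cost another `r / 4`. There are at most `17 * 2 ^ 4` classes.
  refine ⟨fun b => (⌊8 * (X b - X a) / r⌋, T b ∩ I), Finset.Icc (-8) 8 ×ˢ I.powerset, ?_, ?_, ?_⟩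
  · have h1 : I.card ≤ 4 := card_freeLevels_le hq0 hi₀'
    rw [Finset.card_product, Finset.card_powerset, Int.card_Icc]
    have h2 : 2 ^ I.card ≤ 2 ^ 4 := Nat.pow_le_pow_right (by norm_num) h1
    calc _ ≤ 17 * 2 ^ 4 := Nat.mul_le_mul (by norm_num) h2
      _ ≤ _ := by norm_num
  · intro b hb hba
    have h1 := abs_le.1 (hX b hb hba)
    simp only [Finset.mem_product, Finset.mem_Icc, Finset.mem_powerset]
    refine ⟨⟨Int.le_floor.2 ?_, ?_⟩, Finset.inter_subset_right⟩
    · rw [le_div_iff₀ hr]; push_cast; linarith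
    · rw [← Int.lt_add_one_iff, Int.floor_lt, div_lt_iff₀ hr]; push_cast; linarith
  · intro b hb c hc hba hca hbc
    rw [Prod.mk.injEq] at hbc
    have h1 : |X b - X c| ≤ r / 8 := by
      have h2 := Int.abs_sub_lt_one_of_floor_eq_floor hbc.1
      rw [← sub_div, abs_div, abs_of_pos hr, div_lt_one hr, ← mul_sub, abs_mul,
        abs_of_pos (by norm_num : (0 : ℝ) < 8), sub_sub_sub_cancel_right] at h2
      linarith
    have h2 := dist_laaksoPoint_same_signs hq k (X b) (X c) (T b)
    have h3 := dist_laaksoPoint_same_abscissa hq k (X c) (T b) (T c) i₀ fun i hi hik => by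
      by_cases hiI : i ∈ I
      · left
        have := Finset.ext_iff.1 hbc.2 i
        simpa [hiI] using this
      · rcases hT b hb hba i hi hik hiI with h | h
        · exact Or.inr (h _ (hX c hc hca))
        · rcases hT c hc hca i hi hik hiI with h' | h'
          · exact Or.inr (h' _ (hX c hc hca))
          · exact Or.inl (h.trans h'.symm)
    have h4 := dist_triangle (laaksoPoint q k (X b) (T b)) (laaksoPoint q k (X c) (T b))
      (laaksoPoint q k (X c) (T c))
    rw [← hXT b hb, ← hXT c hc]
    linarith

/-! ### Uniform convexity on balls -/

/-- A homogeneous form of `p`-uniform convexity on balls, with constant `c`. -/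
def PowerConvexOnBalls (p c : ℝ) (Y : Type*) [NormedAddCommGroup Y] : Prop :=
  ∀ R : ℝ, 0 < R → ∀ x y : Y, ‖x‖ ≤ R → ‖y‖ ≤ R →
    ‖x + y‖ ≤ 2 * (R - c * R ^ (1 - p) * ‖x - y‖ ^ p)

/-- The parallelogram law, made linear in `‖x + y‖` by `4R‖x + y‖ ≤ ‖x + y‖² + 4R²`. -/
lemma powerConvexOnBalls_inner (H : Type*) [NormedAddCommGroup H] [InnerProductSpace ℝ H] :
    PowerConvexOnBalls 2 (1 / 8) H := by
  intro R hR x y hx hy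
  have h1 := parallelogram_law_with_norm ℝ x y
  have e : R ^ (1 - 2 : ℝ) = R⁻¹ := by rw [← Real.rpow_neg_one]; norm_num
  rw [e, Real.rpow_two]
  have hx2 : ‖x‖ ^ 2 ≤ R ^ 2 := pow_le_pow_left₀ (norm_nonneg _) hx 2
  have hy2 : ‖y‖ ^ 2 ≤ R ^ 2 := pow_le_pow_left₀ (norm_nonneg _) hy 2
  have h2 : 4 * R * ‖x + y‖ ≤ ‖x + y‖ ^ 2 + 4 * R ^ 2 := by nlinarith [sq_nonneg (‖x + y‖ - 2 * R)]
  have h3 : 2 * (R - 1 / 8 * R⁻¹ * ‖x - y‖ ^ 2) = (8 * R ^ 2 - ‖x - y‖ ^ 2) / (4 * R) := by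
    field_simp; ring
  rw [h3, le_div_iff₀ (by positivity)]
  linarith

section
variable {Y : Type*} [NormedAddCommGroup Y] [NormedSpace ℝ Y]

lemma norm_add_le_of_unit {p c : ℝ} (hp : 0 < p)
    (h : ∀ t : ℝ, 0 < t → ((c * t ^ p : ℝ) : EReal) ≤ convexityModulus Y t) {x y : Y}
    (hx : ‖x‖ = 1) (hy : ‖y‖ = 1) : ‖x + y‖ ≤ 2 * (1 - c * ‖x - y‖ ^ p) := by
  rcases (norm_nonneg (x - y)).eq_or_lt with h0 | h0
  · rw [← h0, Real.zero_rpow hp.ne']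
    have := norm_add_le x y
    linarith
  · have h1 : convexityModulus Y ‖x - y‖ ≤ ((1 - ‖(2⁻¹ : ℝ) • (x + y)‖ : ℝ) : EReal) :=
      iInf_le_of_le x <| iInf_le_of_le y <| iInf_le_of_le hx <| iInf_le_of_le hy <|
        iInf_le_of_le le_rfl le_rfl
    have h2 := (h _ h0).trans h1
    rw [EReal.coe_le_coe_iff, norm_smul] at h2
    norm_num at h2
    linarith

lemma norm_add_le_of_unit_ball {p c : ℝ} (hp : 1 ≤ p) (hc : 0 < c)
    (h : ∀ x y : Y, ‖x‖ = 1 → ‖y‖ = 1 → ‖x + y‖ ≤ 2 * (1 - c * ‖x - y‖ ^ p)) {x y : Y}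
    (hx : ‖x‖ ≤ 1) (hy : ‖y‖ ≤ 1) :
    ‖x + y‖ ≤ 2 * (1 - min (1 / 4) (c / 2) / 2 ^ p * ‖x - y‖ ^ p) := by
  wlog hxy : ‖y‖ ≤ ‖x‖ generalizing x y
  · rw [add_comm, norm_sub_rev]
    exact this hy hx (not_le.1 hxy).le
  set t := ‖x - y‖ with ht
  have ht0 : 0 ≤ t := norm_nonneg _
  have ht2 : t / 2 ≤ 1 := by
    have := norm_sub_le x y
    linarith
  have e : min (1 / 4) (c / 2) / 2 ^ p * t ^ p = min (1 / 4) (c / 2) * (t / 2) ^ p := by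
    rw [Real.div_rpow ht0 (by norm_num)]; ring
  rw [e]
  have h0 : 0 ≤ (t / 2) ^ p := by positivity
  -- If `y` is short, the triangle inequality already gains `t / 4`, and `(t / 2) ^ p ≤ t / 2`.
  -- Otherwise normalizing moves the two points by at most `t / 2` in total, and `‖y‖ ≥ 1 / 2`.
  rcases le_or_gt ‖y‖ (1 - t / 4) with hb | hb
  · have h1 : (t / 2) ^ p ≤ t / 2 := by
      simpa using Real.rpow_le_rpow_of_exponent_ge' (by positivity) ht2 zero_le_one hp
    have h2 := mul_le_mul_of_nonneg_right (min_le_left (1 / 4 : ℝ) (c / 2)) h0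
    have := norm_add_le x y
    linarith
  · have hb0 : 0 < ‖y‖ := by linarith
    have ha0 : 0 < ‖x‖ := by linarith
    set x' := ‖x‖⁻¹ • x with hx'
    set y' := ‖y‖⁻¹ • y with hy'
    have hxx : x = ‖x‖ • x' := by rw [hx', smul_inv_smul₀ ha0.ne']
    have hyy : y = ‖y‖ • y' := by rw [hy', smul_inv_smul₀ hb0.ne']
    have hx1 : ‖x'‖ = 1 := by rw [hx', norm_smul, norm_inv, norm_norm, inv_mul_cancel₀ ha0.ne']
    have hy1 : ‖y'‖ = 1 := by rw [hy', norm_smul, norm_inv, norm_norm, inv_mul_cancel₀ hb0.ne']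
    have h1 := h x' y' hx1 hy1
    have hd : t / 2 ≤ ‖x' - y'‖ := by
      have e1 : x - y = (x' - y') - (1 - ‖x‖) • x' + (1 - ‖y‖) • y' := by
        conv_lhs => rw [hxx, hyy]
        module
      have h2 : t ≤ ‖x' - y'‖ + (1 - ‖x‖) + (1 - ‖y‖) := by
        rw [ht, e1]
        refine (norm_add_le _ _).trans (add_le_add ((norm_sub_le _ _).trans ?_) ?_)
        · rw [norm_smul, hx1, Real.norm_of_nonneg (by linarith)]; linarith
        · rw [norm_smul, hy1, Real.norm_of_nonneg (by linarith)]; linarith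
      linarith
    have h3 : (t / 2) ^ p ≤ ‖x' - y'‖ ^ p := Real.rpow_le_rpow (by positivity) hd (by linarith)
    have h4 : ‖x + y‖ ≤ ‖y‖ * ‖x' + y'‖ + (‖x‖ - ‖y‖) := by
      have e1 : x + y = ‖y‖ • (x' + y') + (‖x‖ - ‖y‖) • x' := by
        conv_lhs => rw [hxx, hyy]
        module
      conv_lhs => rw [e1]
      refine (norm_add_le _ _).trans (add_le_add ?_ ?_)
      · rw [norm_smul, norm_norm]
      · rw [norm_smul, hx1, Real.norm_of_nonneg (by linarith)]; linarith
    have h5 := mul_le_mul_of_nonneg_left h1 hb0.le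
    have h6 : min (1 / 4) (c / 2) * (t / 2) ^ p ≤ c / 2 * (t / 2) ^ p :=
      mul_le_mul_of_nonneg_right (min_le_right _ _) h0
    have h7 : c * (t / 2) ^ p ≤ c * ‖x' - y'‖ ^ p := mul_le_mul_of_nonneg_left h3 hc.le
    have h8 : 1 / 2 * (c * (t / 2) ^ p) ≤ ‖y‖ * (c * ‖x' - y'‖ ^ p) :=
      mul_le_mul (by linarith) h7 (by positivity) hb0.le
    linarith

lemma exists_powerConvexOnBalls {p : ℝ} (hp : 1 ≤ p) (h : IsPowerUniformlyConvex p Y) :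
    ∃ c : ℝ, 0 < c ∧ PowerConvexOnBalls p c Y := by
  obtain ⟨c, hc, h⟩ := h
  refine ⟨min (1 / 4) (c / 2) / 2 ^ p, by positivity, fun R hR x y hx hy => ?_⟩
  have h1 := norm_add_le_of_unit_ball hp hc (fun x y hx hy => norm_add_le_of_unit (by linarith) h
    hx hy) (x := R⁻¹ • x) (y := R⁻¹ • y)
    (by rw [norm_smul, Real.norm_of_nonneg (by positivity), inv_mul_le_iff₀ hR]; linarith)
    (by rw [norm_smul, Real.norm_of_nonneg (by positivity), inv_mul_le_iff₀ hR]; linarith)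
  rw [← smul_add, ← smul_sub, norm_smul, norm_smul, Real.norm_of_nonneg (by positivity),
    Real.mul_rpow (by positivity) (norm_nonneg _), inv_mul_le_iff₀ hR,
    Real.inv_rpow hR.le] at h1
  rw [Real.rpow_sub hR, Real.rpow_one]
  refine h1.trans (le_of_eq ?_)
  ring

end

/-! ### The grid of vertices -/

lemma laaksoPoint_congr {q : ℝ} {k : ℕ} {x : ℝ} {T T' : Finset ℕ}
    (h : ∀ i < k, (i ∈ T ↔ i ∈ T') ∨ levelBump q k i x = 0) :
    laaksoPoint q k x T = laaksoPoint q k x T' := by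
  ext i
  cases i with
  | zero => rfl
  | succ i =>
    rcases lt_or_ge i k with hi | hi
    · rw [laaksoPoint_succ q k x T hi, laaksoPoint_succ q k x T' hi]
      rcases h i hi with h | h
      · rw [levelSign_eq h]
      · rw [h, mul_zero, mul_zero]
    · rw [laaksoPoint_succ_of_le q k x T hi, laaksoPoint_succ_of_le q k x T' hi]

/-- The vertices of the Laakso-type graph with `k` levels in `ℓ_q`. -/
noncomputable def laaksoGrid (q : ℝ) (k : ℕ) : Finset (EllSeq q) :=
  open Classical in
  (Finset.range (4 ^ k + 1) ×ˢ (Finset.range k).powerset).image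
    fun z => laaksoPoint q k ((z.1 : ℝ) / 4 ^ k) z.2

lemma laaksoPoint_mem_laaksoGrid {q : ℝ} {k j m : ℕ} (hj : j ≤ k) (hm : m ≤ 4 ^ j)
    {T : Finset ℕ} (hT : T ⊆ Finset.range k) :
    laaksoPoint q k ((m : ℝ) / 4 ^ j) T ∈ laaksoGrid q k := by
  classical
  obtain ⟨l, rfl⟩ := Nat.exists_eq_add_of_le hj
  refine Finset.mem_image.2 ⟨(m * 4 ^ l, T), ?_, ?_⟩
  · simp only [Finset.mem_product, Finset.mem_range, Finset.mem_powerset]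
    refine ⟨?_, hT⟩
    rw [pow_add, Nat.lt_succ_iff]
    exact Nat.mul_le_mul_right _ hm
  · congr 1
    push_cast
    rw [pow_add]
    field_simp

lemma exists_of_mem_laaksoGrid {q : ℝ} {k : ℕ} {a : EllSeq q} (ha : a ∈ laaksoGrid q k) :
    ∃ x T, laaksoPoint q k x T = a := by
  classical
  obtain ⟨z, -, h⟩ := Finset.mem_image.1 ha
  exact ⟨_, _, h⟩

lemma card_laaksoGrid_le (q : ℝ) (k : ℕ) : (laaksoGrid q k).card ≤ 2 * 8 ^ k := by
  classical
  refine Finset.card_image_le.trans ?_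
  rw [Finset.card_product, Finset.card_range, Finset.card_powerset, Finset.card_range]
  calc (4 ^ k + 1) * 2 ^ k ≤ (2 * 4 ^ k) * 2 ^ k :=
        Nat.mul_le_mul_right _ (by have := Nat.one_le_pow k 4 (by norm_num); omega)
    _ = 2 * 8 ^ k := by rw [mul_assoc, ← mul_pow]; norm_num

/-! ### Shortening of edges under uniform convexity -/

section
variable {q : ℝ} {Y : Type*} [NormedAddCommGroup Y] [NormedSpace ℝ Y]

/-- The images of all pairs of points spanning an edge of level `j` are at distance at most
`R / 4 ^ j`. -/
def EdgeBound (k : ℕ) (g : EllSeq q → Y) (j : ℕ) (R : ℝ) : Prop :=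
  ∀ m < 4 ^ j, ∀ T ⊆ Finset.range k,
    4 ^ j * ‖g (laaksoPoint q k (((m + 1 : ℕ) : ℝ) / 4 ^ j) T) -
      g (laaksoPoint q k ((m : ℝ) / 4 ^ j) T)‖ ≤ R

variable [Fact (1 ≤ ENNReal.ofReal q)] {k : ℕ} {g : EllSeq q → Y} {D η : ℝ}

/-- The bump of level `j` vanishes at the first and third quarter of the edge, so both signs share
these endpoints but have different midpoints. Convexity applied to the two halves of this diamond
shortens its diagonal; the outer quarters gain nothing. -/
lemma edgeBound_step (hq : 1 ≤ q)
    (hlow : ∀ a ∈ laaksoGrid q k, ∀ b ∈ laaksoGrid q k, dist a b ≤ ‖g a - g b‖)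
    {j : ℕ} (hj : j < k) {R : ℝ}
    (hconv : ∀ x y : Y, ‖x‖ ≤ R → ‖y‖ ≤ R → 2 * bumpHeight q k ≤ ‖x - y‖ → ‖x + y‖ ≤ 2 * (R - η))
    (h : EdgeBound k g (j + 1) R) : EdgeBound k g j (R - η / 2) := by
  intro m hm T hT
  set x : ℕ → ℝ := fun i => ((4 * m + i : ℕ) : ℝ) / 4 ^ (j + 1) with hx
  set G : ℕ → Finset ℕ → Y := fun i T => g (laaksoPoint q k (x i) T) with hG
  have hedge : ∀ i < 4, ∀ T ⊆ Finset.range k, 4 ^ (j + 1) * ‖G (i + 1) T - G i T‖ ≤ R :=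
    fun i hi T hT => h (4 * m + i) (by rw [pow_succ]; omega) T hT
  have hx0 : (m : ℝ) / 4 ^ j = x 0 := by
    simp only [hx]; push_cast; rw [pow_succ]; field_simp; ring
  have hx4 : ((m + 1 : ℕ) : ℝ) / 4 ^ j = x 4 := by
    simp only [hx]; push_cast; rw [pow_succ]; field_simp
  have hxj : ∀ i : ℕ, 4 ^ j * x i = m + i / 4 := fun i => by
    simp only [hx]; push_cast; rw [pow_succ]; field_simp
  have hb1 : levelBump q k j (x 1) = 0 := by
    rw [levelBump, hxj, bump_eq_zero m, mul_zero]
    push_cast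
    rw [abs_of_nonneg] <;> linarith
  have hb3 : levelBump q k j (x 3) = 0 := by
    rw [levelBump, hxj, bump_eq_zero (m + 1), mul_zero]
    push_cast
    rw [abs_of_nonpos] <;> linarith
  have hb2 : levelBump q k j (x 2) = bumpHeight q k / 4 ^ j / 4 := by
    rw [levelBump, hxj, show (m : ℝ) + (2 : ℕ) / 4 = m + 1 / 2 by push_cast; ring, bump_add_half]
    ring
  have hcong : ∀ i, levelBump q k j (x i) = 0 → ∀ T' : Finset ℕ,
      (∀ l, l ≠ j → (l ∈ T' ↔ l ∈ T)) → G i T' = G i T := by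
    intro i hi T' hT'
    simp only [hG]
    rw [laaksoPoint_congr (T' := T)]
    intro l _
    by_cases hl : l = j
    · exact Or.inr (hl ▸ hi)
    · exact Or.inl (hT' l hl)
  have hins : insert j T ⊆ Finset.range k := Finset.insert_subset (by simpa using hj) hT
  have hers : T.erase j ⊆ Finset.range k := (Finset.erase_subset _ _).trans hT
  have ei : ∀ l, l ≠ j → (l ∈ insert j T ↔ l ∈ T) := fun l hl => by simp [hl]
  have ee : ∀ l, l ≠ j → (l ∈ T.erase j ↔ l ∈ T) := fun l hl => by simp [hl]
  have h4 : (0 : ℝ) < 4 ^ (j + 1) := by positivity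
  have hsm : ∀ v : Y, ‖(4 : ℝ) ^ (j + 1) • v‖ = 4 ^ (j + 1) * ‖v‖ := fun v => by
    rw [norm_smul, Real.norm_of_nonneg h4.le]
  have hsep : 2 * bumpHeight q k ≤ 4 ^ (j + 1) * ‖G 2 (insert j T) - G 2 (T.erase j)‖ := by
    have hm2 : 4 * m + 2 ≤ 4 ^ (j + 1) := by rw [pow_succ]; omega
    have h1 := hlow _ (laaksoPoint_mem_laaksoGrid (q := q) hj hm2 hins) _
      (laaksoPoint_mem_laaksoGrid (q := q) hj hm2 hers)
    have h2 := (add_levelBump_le_dist_laaksoPoint (by linarith) hj (x 2) (x 2) (q := q)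
      (T := insert j T) (T' := T.erase j) (by simp)).trans h1
    rw [hb2] at h2
    have h3 := mul_le_mul_of_nonneg_left h2 h4.le
    refine le_trans (le_of_eq ?_) h3
    rw [pow_succ]; field_simp; ring
  have hsplit : ∀ T' ⊆ Finset.range k, (∀ l, l ≠ j → (l ∈ T' ↔ l ∈ T)) →
      4 ^ (j + 1) * ‖G 2 T' - G 1 T‖ ≤ R ∧ 4 ^ (j + 1) * ‖G 3 T - G 2 T'‖ ≤ R := by
    intro T' hT' hc
    rw [← hcong 1 hb1 T' hc, ← hcong 3 hb3 T' hc]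
    exact ⟨hedge 1 (by norm_num) T' hT', hedge 2 (by norm_num) T' hT'⟩
  obtain ⟨p1, p2⟩ := hsplit _ hins ei
  obtain ⟨n1, n2⟩ := hsplit _ hers ee
  rw [← hsm] at p1 p2 n1 n2 hsep
  have c1 := hconv _ _ p1 n1 (by rwa [← smul_sub, sub_sub_sub_cancel_right])
  have c2 := hconv _ _ n2 p2 (by rwa [← smul_sub, sub_sub_sub_cancel_left])
  rw [← smul_add, hsm] at c1 c2
  have e : (2 : ℝ) • (G 3 T - G 1 T) =
      (G 2 (insert j T) - G 1 T + (G 2 (T.erase j) - G 1 T)) +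
      (G 3 T - G 2 (T.erase j) + (G 3 T - G 2 (insert j T))) := by module
  have hmid : 2 * ‖G 3 T - G 1 T‖ ≤
      ‖G 2 (insert j T) - G 1 T + (G 2 (T.erase j) - G 1 T)‖ +
      ‖G 3 T - G 2 (T.erase j) + (G 3 T - G 2 (insert j T))‖ := by
    rw [← Real.norm_of_nonneg (zero_le_two (α := ℝ)), ← norm_smul, e]
    exact norm_add_le _ _
  have e0 := hedge 0 (by norm_num) T hT
  have e3 := hedge 3 (by norm_num) T hT
  have htot : ‖G 4 T - G 0 T‖ ≤ ‖G 4 T - G 3 T‖ + ‖G 3 T - G 1 T‖ + ‖G 1 T - G 0 T‖ := by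
    have h1 := norm_sub_le_norm_sub_add_norm_sub (G 4 T) (G 3 T) (G 0 T)
    have h2 := norm_sub_le_norm_sub_add_norm_sub (G 3 T) (G 1 T) (G 0 T)
    linarith
  rw [hx0, hx4]
  change 4 ^ j * ‖G 4 T - G 0 T‖ ≤ R - η / 2
  have htot4 := mul_le_mul_of_nonneg_left htot h4.le
  have hmid4 := mul_le_mul_of_nonneg_left hmid h4.le
  have e4 : (4 : ℝ) ^ (j + 1) * ‖G 4 T - G 0 T‖ = 4 * (4 ^ j * ‖G 4 T - G 0 T‖) := by ring
  norm_num only at e0 e3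
  -- The middle two quarters give `2(R - η)` and the outer ones `2R`; dividing by 4 leaves `R - η /
  -- 2`.
  linarith

lemma levels_mul_gain_le (hq : 1 ≤ q) (hη : 0 ≤ η) (hD : 0 ≤ D)
    (hlow : ∀ a ∈ laaksoGrid q k, ∀ b ∈ laaksoGrid q k, dist a b ≤ ‖g a - g b‖)
    (hup : ∀ a ∈ laaksoGrid q k, ∀ b ∈ laaksoGrid q k, ‖g a - g b‖ ≤ D * dist a b)
    (hconv : ∀ R ≤ 2 * D, ∀ x y : Y, ‖x‖ ≤ R → ‖y‖ ≤ R → 2 * bumpHeight q k ≤ ‖x - y‖ →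
      ‖x + y‖ ≤ 2 * (R - η)) : k * η ≤ 4 * D := by
  have hmain : ∀ i ≤ k, EdgeBound k g (k - i) (2 * D - i * (η / 2)) := by
    intro i
    induction i with
    | zero =>
      intro _ m hm T hT
      have h1 := hup _ (laaksoPoint_mem_laaksoGrid (q := q) (m := m + 1) le_rfl hm hT) _
        (laaksoPoint_mem_laaksoGrid (q := q) le_rfl hm.le hT)
      have h2 := dist_laaksoPoint_same_signs hq k (((m + 1 : ℕ) : ℝ) / 4 ^ k) ((m : ℝ) / 4 ^ k) T
      have e : ((m + 1 : ℕ) : ℝ) / 4 ^ k - (m : ℝ) / 4 ^ k = 1 / 4 ^ k := by push_cast; ring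
      rw [e, abs_of_pos (by positivity)] at h2
      have h3 := h1.trans (mul_le_mul_of_nonneg_left h2 hD)
      rw [Nat.sub_zero]
      have h4 := mul_le_mul_of_nonneg_left h3 (by positivity : (0 : ℝ) ≤ 4 ^ k)
      refine h4.trans (le_of_eq ?_)
      push_cast
      field_simp
      ring
    | succ i ih =>
      intro hi
      have h1 := ih (by omega)
      rw [show k - i = k - (i + 1) + 1 by omega] at h1
      have h2 : 2 * D - i * (η / 2) ≤ 2 * D := by
        have : 0 ≤ (i : ℝ) * (η / 2) := by positivity
        linarith
      have h3 := edgeBound_step hq hlow (by omega) (hconv _ h2) h1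
      refine fun m hm T hT => (h3 m hm T hT).trans (le_of_eq ?_)
      push_cast; ring
  -- At level 0 the bound `2D - kη / 2` dominates a norm, hence is nonnegative.
  have h1 := hmain k le_rfl 0 (by positivity) ∅ (by simp)
  have h2 := (mul_nonneg (by positivity) (norm_nonneg _)).trans h1
  linarith

lemma levels_mul_le_distortion_rpow (hq : 1 ≤ q) {p c : ℝ} (hp : 1 ≤ p) (hc : 0 < c)
    (hY : PowerConvexOnBalls p c Y) (hD : 1 ≤ D)
    (hlow : ∀ a ∈ laaksoGrid q k, ∀ b ∈ laaksoGrid q k, dist a b ≤ ‖g a - g b‖)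
    (hup : ∀ a ∈ laaksoGrid q k, ∀ b ∈ laaksoGrid q k, ‖g a - g b‖ ≤ D * dist a b) :
    k * c * bumpHeight q k ^ p ≤ 2 * D ^ p := by
  have hδ := bumpHeight_pos q k
  have hD0 : 0 < 2 * D := by linarith
  have h1 := levels_mul_gain_le (η := c * (2 * D) ^ (1 - p) * (2 * bumpHeight q k) ^ p) hq
    (by positivity) (by linarith) hlow hup ?_
  · have h2 := mul_le_mul_of_nonneg_right h1 (by positivity : 0 ≤ (2 * D) ^ (p - 1))
    have e1 : (2 * D) ^ (1 - p) * (2 * D) ^ (p - 1) = 1 := by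
      rw [← Real.rpow_add hD0]; simp
    have e2 : 2 * D * (2 * D) ^ (p - 1) = 2 ^ p * D ^ p := by
      rw [← Real.rpow_one_add' hD0.le (by linarith), ← Real.mul_rpow (by norm_num) (by linarith)]
      congr 1; ring
    have e3 : (2 * bumpHeight q k) ^ p = 2 ^ p * bumpHeight q k ^ p :=
      Real.mul_rpow (by norm_num) hδ.le
    have h3 : 2 ^ p * (k * c * bumpHeight q k ^ p) ≤ 2 ^ p * (2 * D ^ p) := by
      calc _ = k * (c * (2 * bumpHeight q k) ^ p) * 1 := by rw [e3]; ring
        _ = k * (c * (2 * D) ^ (1 - p) * (2 * bumpHeight q k) ^ p) * (2 * D) ^ (p - 1) := by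
          linear_combination (-(k * c * (2 * bumpHeight q k) ^ p)) * e1
        _ ≤ 4 * D * (2 * D) ^ (p - 1) := h2
        _ = 2 * (2 * D * (2 * D) ^ (p - 1)) := by ring
        _ = _ := by rw [e2]; ring
    exact le_of_mul_le_mul_left h3 (by positivity)
  · intro R hR x y hx hy hxy
    -- Two points of the ball of radius `R` are at least `2δ > 0` apart. Then `R ≤ 2D` and `1 - p ≤
    -- 0` allow one gain `η` for all `R`.
    have hR0 : 0 < R := by
      have := norm_sub_le x y
      linarith
    refine (hY R hR0 x y hx hy).trans ?_
    have h3 : (2 * D) ^ (1 - p) ≤ R ^ (1 - p) :=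
      Real.rpow_le_rpow_of_nonpos hR0 hR (by linarith)
    have h4 : (2 * bumpHeight q k) ^ p ≤ ‖x - y‖ ^ p :=
      Real.rpow_le_rpow (by positivity) hxy (by linarith)
    have h5 : c * (2 * D) ^ (1 - p) * (2 * bumpHeight q k) ^ p ≤ c * R ^ (1 - p) * ‖x - y‖ ^ p := by
      gcongr
    linarith

end

/-! ### Sets of exactly `n` points and the lower bound -/

/-- Padding by points with integer abscissae or others of the same family is harmless, since the
doubling bound holds for every set of such points. -/
lemma exists_laaksoSet (q : ℝ) (k n : ℕ) :
    ∃ S : Finset (EllSeq q), S.card = n ∧ (∀ a ∈ S, ∃ x T, laaksoPoint q k x T = a) ∧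
      (2 * 8 ^ k ≤ n → laaksoGrid q k ⊆ S) := by
  classical
  set A : Set (EllSeq q) := {a | ∃ x T, laaksoPoint q k x T = a} with hA
  have hinf : A.Infinite := by
    refine Set.infinite_of_injective_forall_mem (f := fun m : ℕ => laaksoPoint q k m ∅) ?_
      fun m => ⟨m, ∅, rfl⟩
    intro a b hab
    have h := congrArg (fun f : EllSeq q => f 0) hab
    simpa [laaksoPoint_zero] using h
  have key : ∀ B : Finset (EllSeq q), (B : Set (EllSeq q)) ⊆ A → B.card ≤ n →
      ∃ S : Finset (EllSeq q), S.card = n ∧ (∀ a ∈ S, a ∈ A) ∧ B ⊆ S := by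
    intro B hB hn
    obtain ⟨t, ht, htn⟩ := (hinf.sdiff B.finite_toSet).exists_subset_card_eq (n - B.card)
    refine ⟨B ∪ t, ?_, fun a ha => ?_, Finset.subset_union_left⟩
    · rw [Finset.card_union_of_disjoint, htn]
      · omega
      · exact Finset.disjoint_left.2 fun a haB hat => (ht hat).2 haB
    · rcases Finset.mem_union.1 ha with h | h
      · exact hB h
      · exact (ht h).1
  by_cases h : 2 * 8 ^ k ≤ n
  · obtain ⟨S, h1, h2, h3⟩ := key (laaksoGrid q k) (fun a ha => exists_of_mem_laaksoGrid ha)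
      ((card_laaksoGrid_le q k).trans h)
    exact ⟨S, h1, h2, fun _ => h3⟩
  · obtain ⟨S, h1, h2, -⟩ := key ∅ (by simp) (by simp)
    exact ⟨S, h1, h2, fun h' => absurd h' h⟩

/-- The number of levels used for an `n`-point set. -/
noncomputable def laaksoLevels (n : ℕ) : ℕ := ⌊Real.log n / 3⌋₊

lemma two_mul_eight_pow_laaksoLevels_le {n : ℕ} (h : 1 ≤ laaksoLevels n) :
    2 * 8 ^ laaksoLevels n ≤ n := by
  have hk : (laaksoLevels n : ℝ) ≤ Real.log n / 3 :=
    Nat.floor_le (div_nonneg (Real.log_natCast_nonneg n) (by norm_num))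
  have h1 : (1 : ℝ) ≤ laaksoLevels n := by exact_mod_cast h
  have hn : (0 : ℝ) < n := by
    rcases Nat.eq_zero_or_pos n with h0 | h0
    · subst h0
      rw [Nat.cast_zero, Real.log_zero] at hk
      linarith
    · exact_mod_cast h0
  -- For `k ≥ 1` one has `(3k + 1) log 2 ≤ 3k`.
  have h2 : Real.log ((2 : ℝ) * 8 ^ laaksoLevels n) ≤ Real.log n := by
    rw [Real.log_mul (by norm_num) (by positivity), Real.log_pow,
      show (8 : ℝ) = 2 ^ 3 by norm_num, Real.log_pow]
    have := Real.log_two_lt_d9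
    push_cast
    nlinarith
  rw [Real.log_le_log_iff (by positivity) hn] at h2
  exact_mod_cast h2

/-- The constant in the lower bound for the distortion. -/
noncomputable def distortionConst (q p c : ℝ) : ℝ :=
  min 1 ((c / 4) ^ (1 / p)) / 3 ^ (1 / p - 1 / q)

lemma distortionConst_pos (q p : ℝ) {c : ℝ} (hc : 0 < c) : 0 < distortionConst q p c := by
  unfold distortionConst; positivity

theorem distortion_ge {q : ℝ} [Fact (1 ≤ ENNReal.ofReal q)] {Y : Type*} [NormedAddCommGroup Y]
    [NormedSpace ℝ Y] {p c D : ℝ} (hp : 1 ≤ p) (hpq : p < q) (hc : 0 < c)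
    (hY : PowerConvexOnBalls p c Y) (hD : 1 ≤ D) {n : ℕ} {S : Finset (EllSeq q)}
    (hS : 1 ≤ laaksoLevels n → laaksoGrid q (laaksoLevels n) ⊆ S) {f : S → Y}
    (hf : EmbedsWithDistortion f D) :
    distortionConst q p c * Real.log n ^ (1 / p - 1 / q) ≤ D := by
  classical
  have hp0 : 0 < p := by linarith
  have hL : 0 ≤ Real.log n := Real.log_natCast_nonneg n
  have hα : 0 < 1 / p - 1 / q := sub_pos.2 (one_div_lt_one_div_of_lt hp0 hpq)
  have e : distortionConst q p c * Real.log n ^ (1 / p - 1 / q) =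
      min 1 ((c / 4) ^ (1 / p)) * (Real.log n / 3) ^ (1 / p - 1 / q) := by
    rw [distortionConst, Real.div_rpow hL (by norm_num)]; ring
  rw [e]
  have hlt : Real.log n / 3 < laaksoLevels n + 1 := Nat.lt_floor_add_one _
  -- With no levels, `log n < 3` and the claim reduces to `D ≥ 1`; hence the minimum with 1 in the
  -- constant.
  rcases Nat.eq_zero_or_pos (laaksoLevels n) with h0 | h0
  · rw [h0, Nat.cast_zero, zero_add] at hlt
    have h1 : (Real.log n / 3) ^ (1 / p - 1 / q) ≤ 1 :=
      Real.rpow_le_one (by positivity) hlt.le hα.le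
    have h2 := mul_le_mul (min_le_left 1 ((c / 4) ^ (1 / p))) h1 (by positivity) zero_le_one
    linarith
  · have hSk := hS h0
    obtain ⟨s, hs, hf⟩ := hf
    set k := laaksoLevels n
    set g : EllSeq q → Y := fun a => if h : a ∈ S then s⁻¹ • f ⟨a, h⟩ else 0 with hg
    have hgn : ∀ a (ha : a ∈ S) b (hb : b ∈ S),
        ‖g a - g b‖ = s⁻¹ * dist (f ⟨a, ha⟩) (f ⟨b, hb⟩) := by
      intro a ha b hb
      simp only [hg, dif_pos ha, dif_pos hb]
      rw [← smul_sub, norm_smul, Real.norm_of_nonneg (by positivity), dist_eq_norm]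
    have h1 := levels_mul_le_distortion_rpow (g := g) (k := k) (hp.trans hpq.le) hp hc hY hD
      (fun a ha b hb => by
        rw [hgn a (hSk ha) b (hSk hb), le_inv_mul_iff₀ hs]
        exact (hf ⟨a, hSk ha⟩ ⟨b, hSk hb⟩).1)
      (fun a ha b hb => by
        rw [hgn a (hSk ha) b (hSk hb), inv_mul_le_iff₀ hs]
        refine (hf ⟨a, hSk ha⟩ ⟨b, hSk hb⟩).2.trans (le_of_eq ?_)
        rw [Subtype.dist_eq]; ring)
    have hk1 : (1 : ℝ) ≤ k := by exact_mod_cast h0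
    have hk0 : (0 : ℝ) < k + 1 := by linarith
    have h2 : ((c / 4) ^ (1 / p) * ((k : ℝ) + 1) ^ (1 / p - 1 / q)) ^ p ≤ D ^ p := by
      rw [Real.mul_rpow (by positivity) (by positivity), ← Real.rpow_mul (by positivity),
        ← Real.rpow_mul hk0.le, one_div_mul_cancel hp0.ne', Real.rpow_one,
        show (1 / p - 1 / q) * p = 1 + -(p / q) by field_simp; ring,
        Real.rpow_add hk0, Real.rpow_one, ← bumpHeight_rpow]
      have h3 : 0 ≤ c * bumpHeight q k ^ p := by
        have := bumpHeight_pos q k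
        positivity
      -- Uses `k ≥ (k + 1) / 2`, which turns `c / 2` into `c / 4`.
      nlinarith
    have h3 := (Real.rpow_le_rpow_iff (by positivity) (by linarith) hp0).1 h2
    refine le_trans (mul_le_mul (min_le_right _ _) ?_ (by positivity) (by positivity)) h3
    exact Real.rpow_le_rpow (by positivity) hlt.le hα.le

/-! ### Comparing `ℓ_q^d` with Euclidean space -/

section
variable {q : ℝ} {d : ℕ}

lemma norm_ellFin_nonneg (hq : 0 < q) (v : EllFin q d) : 0 ≤ ‖v‖ := by
  rw [PiLp.norm_eq_sum (by rwa [ENNReal.toReal_ofReal hq.le])]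
  positivity

lemma norm_ellFin_rpow (hq : 0 < q) (v : Fin d → ℝ) :
    ‖(WithLp.toLp (ENNReal.ofReal q) v : EllFin q d)‖ ^ q = ∑ i, |v i| ^ q := by
  have hq' : (ENNReal.ofReal q).toReal = q := ENNReal.toReal_ofReal hq.le
  rw [PiLp.norm_eq_sum (by rwa [hq']), hq', ← Real.rpow_mul (by positivity),
    one_div_mul_cancel hq.ne', Real.rpow_one]
  rfl

lemma norm_ellFin_le_norm_euclidean (hq : 2 ≤ q) (v : Fin d → ℝ) :
    ‖(WithLp.toLp (ENNReal.ofReal q) v : EllFin q d)‖ ≤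
      ‖(WithLp.toLp 2 v : EuclideanSpace ℝ (Fin d))‖ := by
  have hq0 : 0 < q := by linarith
  set N := ‖(WithLp.toLp 2 v : EuclideanSpace ℝ (Fin d))‖ with hN
  have hN2 : N ^ 2 = ∑ i, |v i| ^ 2 := by
    rw [hN, EuclideanSpace.norm_sq_eq]; rfl
  have hpow : ∀ a : ℝ, 0 ≤ a → a ^ q = a ^ 2 * a ^ (q - 2) := fun a ha => by
    rw [← Real.rpow_two, ← Real.rpow_add_of_nonneg ha (by norm_num) (by linarith)]
    congr 1; ring
  have hi : ∀ i, |v i| ≤ N := fun i =>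
    PiLp.norm_apply_le (WithLp.toLp 2 v : EuclideanSpace ℝ (Fin d)) i
  refine (Real.rpow_le_rpow_iff (norm_ellFin_nonneg hq0 _) (norm_nonneg _) hq0).1 ?_
  rw [norm_ellFin_rpow hq0, hpow N (norm_nonneg _), hN2, Finset.sum_mul]
  refine Finset.sum_le_sum fun i _ => ?_
  rw [hpow _ (abs_nonneg _)]
  exact mul_le_mul_of_nonneg_left (Real.rpow_le_rpow (abs_nonneg _) (hi i) (by linarith))
    (by positivity)

/-- The power mean inequality with exponent `q / 2`, applied to the squares of the entries. -/
lemma norm_euclidean_le_norm_ellFin (hq : 2 ≤ q) (v : Fin d → ℝ) :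
    ‖(WithLp.toLp 2 v : EuclideanSpace ℝ (Fin d))‖ ≤
      (d : ℝ) ^ (1 / 2 - 1 / q) * ‖(WithLp.toLp (ENNReal.ofReal q) v : EllFin q d)‖ := by
  have hq0 : 0 < q := by linarith
  set N := ‖(WithLp.toLp 2 v : EuclideanSpace ℝ (Fin d))‖ with hN
  have hN2 : N ^ 2 = ∑ i, |(|v i| ^ 2)| := by
    rw [hN, EuclideanSpace.norm_sq_eq]
    simp
  have h1 := Real.rpow_sum_le_const_mul_sum_rpow Finset.univ (fun i => |v i| ^ 2)
    (p := q / 2) (by linarith)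
  rw [← hN2, Finset.card_univ, Fintype.card_fin] at h1
  have hpow : ∀ a : ℝ, 0 ≤ a → (a ^ 2) ^ (q / 2) = a ^ q := fun a ha => by
    rw [← Real.rpow_two, ← Real.rpow_mul ha]
    congr 1; ring
  have hM : 0 ≤ ‖(WithLp.toLp (ENNReal.ofReal q) v : EllFin q d)‖ := norm_ellFin_nonneg hq0 _
  refine (Real.rpow_le_rpow_iff (norm_nonneg _) (by positivity) hq0).1 ?_
  rw [Real.mul_rpow (by positivity) hM, norm_ellFin_rpow hq0,
    ← Real.rpow_mul (by positivity), ← hpow N (norm_nonneg _)]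
  refine h1.trans (le_of_eq ?_)
  congr 1
  · congr 1; field_simp
  · refine Finset.sum_congr rfl fun i _ => ?_
    rw [abs_of_nonneg (by positivity : 0 ≤ |v i| ^ 2), hpow _ (abs_nonneg _)]

lemma EmbedsWithDistortion.euclidean [Fact (1 ≤ ENNReal.ofReal q)] (hq : 2 ≤ q) {X Y : Type*}
    [MetricSpace X] [NormedAddCommGroup Y] [NormedSpace ℝ Y] {f : X → Y} {D : ℝ}
    (hf : EmbedsWithDistortion f D) (e : Y ≃ₗᵢ[ℝ] EllFin q d) :
    EmbedsWithDistortion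
      (fun x => (WithLp.toLp 2 (WithLp.ofLp (e (f x))) : EuclideanSpace ℝ (Fin d)))
      (D * (d : ℝ) ^ (1 / 2 - 1 / q)) := by
  obtain ⟨s, hs, hf⟩ := hf
  refine ⟨s, hs, fun x y => ?_⟩
  obtain ⟨h1, h2⟩ := hf x y
  set v : Fin d → ℝ := WithLp.ofLp (e (f x) - e (f y)) with hv
  have e1 : dist (f x) (f y) = ‖(WithLp.toLp (ENNReal.ofReal q) v : EllFin q d)‖ := by
    rw [← e.dist_map, dist_eq_norm, hv, WithLp.toLp_ofLp]
  have e2 : dist (WithLp.toLp 2 (WithLp.ofLp (e (f x))) : EuclideanSpace ℝ (Fin d))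
      (WithLp.toLp 2 (WithLp.ofLp (e (f y)))) =
      ‖(WithLp.toLp 2 v : EuclideanSpace ℝ (Fin d))‖ := by
    rw [dist_eq_norm, hv, WithLp.ofLp_sub, WithLp.toLp_sub]
  rw [e1] at h1 h2
  rw [e2]
  refine ⟨h1.trans (norm_ellFin_le_norm_euclidean hq v),
    (norm_euclidean_le_norm_ellFin hq v).trans ?_⟩
  calc _ ≤ (d : ℝ) ^ (1 / 2 - 1 / q) * (D * s * dist x y) :=
        mul_le_mul_of_nonneg_left h2 (by positivity)
    _ = _ := by ring

end

/-! ### The main theorem -/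

theorem mainTheorem3 (q : ℝ) (hq : 2 < q) [Fact (1 ≤ ENNReal.ofReal q)] :
    ∃ c₂ : ℝ, 0 < c₂ ∧
      ∀ (Y : Type*) [NormedAddCommGroup Y] [NormedSpace ℝ Y] [CompleteSpace Y],
        ∃ c₁ : ℝ → ℝ, (∀ p : ℝ, 0 < c₁ p) ∧
          ∀ (D : ℝ), 1 ≤ D → ∀ n : ℕ,
            ∃ S : Finset (EllSeq q), S.card = n ∧ IsDoublingSpace (2 ^ 32) S ∧
              ∀ f : S → Y, EmbedsWithDistortion f D →
                (∀ p : ℝ, 2 ≤ p → p < q → IsPowerUniformlyConvex p Y →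
                  c₁ p * Real.log n ^ (1 / p - 1 / q) ≤ D) ∧
                (∀ d : ℕ, 1 ≤ d → Nonempty (Y ≃ₗᵢ[ℝ] EllFin q d) →
                  c₂ * (Real.log n / d) ^ (1 / 2 - 1 / q) ≤ D) := by
  refine ⟨distortionConst q 2 (1 / 8), distortionConst_pos q 2 (by norm_num), ?_⟩
  intro Y _ _ _
  have hconst : ∀ p : ℝ, ∃ C : ℝ, 0 < C ∧ (2 ≤ p → IsPowerUniformlyConvex p Y →
      ∃ c : ℝ, 0 < c ∧ PowerConvexOnBalls p c Y ∧ C = distortionConst q p c) := by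
    intro p
    by_cases h : 2 ≤ p ∧ IsPowerUniformlyConvex p Y
    · obtain ⟨c, hc, hY⟩ := exists_powerConvexOnBalls (by linarith) h.2
      exact ⟨_, distortionConst_pos q p hc, fun _ _ => ⟨c, hc, hY, rfl⟩⟩
    · exact ⟨1, one_pos, fun h1 h2 => absurd ⟨h1, h2⟩ h⟩
  choose c₁ hc₁ hc₁' using hconst
  refine ⟨c₁, hc₁, fun D hD n => ?_⟩
  obtain ⟨S, hcard, hpts, hgrid⟩ := exists_laaksoSet q (laaksoLevels n) n
  have hgrid' : 1 ≤ laaksoLevels n → laaksoGrid q (laaksoLevels n) ⊆ S :=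
    fun h => hgrid (two_mul_eight_pow_laaksoLevels_le h)
  refine ⟨S, hcard, isDoublingSpace_of_forall_laaksoPoint (q := q) (by linarith) _ (S : Set (EllSeq q)) hpts,
    fun f hf => ⟨fun p hp hpq hY => ?_, fun d hd ⟨e⟩ => ?_⟩⟩
  · obtain ⟨c, hc, hYc, hC⟩ := hc₁' p hp hY
    rw [hC]
    exact distortion_ge (by linarith) hpq hc hYc hD hgrid' hf
  · have hα : 0 < 1 / 2 - 1 / q := sub_pos.2 (one_div_lt_one_div_of_lt two_pos hq)
    have hd1 : (1 : ℝ) ≤ (d : ℝ) ^ (1 / 2 - 1 / q) :=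
      Real.one_le_rpow (by exact_mod_cast hd) hα.le
    have h1 := distortion_ge one_le_two hq (by norm_num) (powerConvexOnBalls_inner _)
      (one_le_mul_of_one_le_of_one_le hD hd1) hgrid' (hf.euclidean hq.le e)
    rw [Real.div_rpow (Real.log_natCast_nonneg n) (by positivity), mul_div_assoc',
      div_le_iff₀ (by linarith)]
    exact h1
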